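/- Let $C\ge 1$, $p\in[0,1]$ and $0<\epsilon<1$ with $Cp\le 1-\epsilon$, and suppose that independent flips of a coin with unknown heads probability $p$ are available, together with independent auxiliary randomness. Consider the following recursive algorithms. $\mathbf{BF1}(C)$: draw $B\sim\mathrm{Bern}(C/(1+C))$. If $B=0$, return $0$. Otherwise flip the $p$-coin to get $X\sim\mathrm{Bern}(p)$; if $X=1$ return $1$, else return $\mathbf{BF1}(C)$. $\mathbf{BF2}(C,i,\epsilon)$, for $i\in\{0,1,2,\dots\}$: if $i=0$, return $1$. If $i>3.55/\epsilon$, let $\beta=(1-\epsilon/2)/(1-\epsilon)$ and draw $B_1\sim\mathrm{Bern}(\beta^{-i})$; if $B_1=0$ return $0$, else return $\mathbf{BF2}(\beta C,i,\epsilon/2)$. Otherwise let $B_2$ be the output of $\mathbf{BF1}(C)$ and return $\mathbf{BF2}(C,i+1-2B_2,\epsilon)$. Let $T$ be the total number of $p$-coin flips used by $\mathbf{BF2}(C,1,\epsilon)$. Then $$\mathbb{E}[T]\;\le\;\frac{3.55\,C(1+\epsilon^{-1})}{(1-e^{-3.55})(1-2e^{-3.55/2})}\;\le\;5.53\,C(1+\epsilon^{-1}).$$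 -/

import Mathlib

open MeasureTheory ProbabilityTheory
open scoped ENNReal

/-- Control state of the linear Bernoulli factory `BF2`. The recursive calls of `BF2` and of `BF1`
are tail calls, and `BF1` is called from one place of `BF2` only, so no call stack is needed. -/
inductive BFControl where
  /-- A call `BF2(C, i, ε)` is about to be executed. -/
  | bf2 (C : ℝ) (i : ℕ) (ε : ℝ) : BFControl
  /-- A call `BF1(C)` is about to be executed, whose result `B₂` is awaited by `BF2(C, i, ε)`. -/
  | bf1 (C : ℝ) (i : ℕ) (ε : ℝ) : BFControl
  /-- The algorithm has returned `b`. -/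
  | ret (b : Bool) : BFControl

/-- A configuration: the control state and the number of `p`-coin flips made so far. -/
structure BFConfig where
  ctrl : BFControl
  flips : ℕ

/-- One step of the algorithm. Here `u` is a fresh uniform number of `[0, 1]`, from which an
auxiliary Bernoulli variable of known mean `q` is drawn as the indicator of `u < q`, and `x` is the
next flip of the `p`-coin that has not been used yet. The counter `flips` goes up exactly when `x`
is used.

BF2(C, i, ε):
  If `i = 0`, return 1.
  If `i > 3.55 / ε`, let `β = (1 - ε / 2) / (1 - ε)` and draw `B₁` as Bernoulli(`β ^ (-i)`);
    if `B₁ = 0`, return 0, else return BF2(β C, i, ε / 2).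
  Else let `B₂` be the result of BF1(C), and return BF2(C, i + 1 - 2 B₂, ε).

BF1(C):
  Draw `B` as Bernoulli(`C / (1 + C)`). If `B = 0`, return 0.
  Else draw `X` as Bernoulli(`p`); if `X = 1`, return 1, else return BF1(C). -/
noncomputable def bfStep (u : ℝ) (x : Bool) (s : BFConfig) : BFConfig :=
  match s.ctrl with
  | .ret b => ⟨.ret b, s.flips⟩
  | .bf2 C i ε =>
    if i = 0 then ⟨.ret true, s.flips⟩
    else if 3.55 / ε < (i : ℝ) then
      let β : ℝ := (1 - ε / 2) / (1 - ε)
      if u < β ^ (-(i : ℤ)) then ⟨.bf2 (β * C) i (ε / 2), s.flips⟩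
      else ⟨.ret false, s.flips⟩
    else ⟨.bf1 C i ε, s.flips⟩
  | .bf1 C i ε =>
    if u < C / (1 + C) then
      if x then ⟨.bf2 C (i - 1) ε, s.flips + 1⟩
      else ⟨.bf1 C i ε, s.flips + 1⟩
    else ⟨.bf2 C (i + 1) ε, s.flips⟩

/-- The configuration after `n` steps of `BF2(C, i, ε)`, when `u n` is the auxiliary randomness of
step `n` and `x 0, x 1, …` are the successive flips of the `p`-coin. -/
noncomputable def bfRun (C : ℝ) (i : ℕ) (ε : ℝ) (u : ℕ → ℝ) (x : ℕ → Bool) : ℕ → BFConfig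
  | 0 => ⟨.bf2 C i ε, 0⟩
  | n + 1 => bfStep (u n) (x (bfRun C i ε u x n).flips) (bfRun C i ε u x n)

/-- The total number of `p`-coin flips used by `BF2(C, i, ε)` (possibly `∞` if the run does not
terminate). -/
noncomputable def bfDraws (C : ℝ) (i : ℕ) (ε : ℝ) (u : ℕ → ℝ) (x : ℕ → Bool) : ℝ≥0∞ :=
  ⨆ n, ((bfRun C i ε u x n).flips : ℝ≥0∞)

/-! The proof is a potential argument. At fixed `C` and `ε`, one pass through BF1 makes `i` a random
walk. With `r = C * p`, the recurrence for expected flips has homogeneous solutions `1` and `r ^ i`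
and particular solution `-C * i / (1 - r)`. `bfPotential` is the solution that vanishes at `i = 0`
and equals `5.5 * C * (1 + 1 / ε)` at `i = 1` (`bfPotential_harmonic`, `bfPotential_one`).

The only loss is at the first integer `M > 3.55 / ε`, where `ε` is halved. There
`bfPotential_boundary` shows that the new potential, weighted by the survival probability `β ^
(-M)`, does not exceed the old one. Hence the potential bounds the expected flips in `n` steps, by
induction on `n` (`bfMean_le`), and monotone convergence removes `n`. The stated constant lies
between `5.5` and `5.53` (`bound_constants`). -/

/-! ### Numerical estimates and the scaled boundary inequality. -/

lemma exp_neg_71_div_40_le : Real.exp (-(71 / 40)) ≤ 0.1695 := by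
  have h1 : (2.7182818283 : ℝ) < Real.exp 1 := Real.exp_one_gt_d9
  have h2 := Real.sum_le_exp_of_nonneg (x := 31 / 40) (by norm_num) 8
  norm_num [Finset.sum_range_succ, Nat.factorial] at h2
  have h3 : Real.exp (71 / 40) = Real.exp 1 * Real.exp (31 / 40) := by
    rw [← Real.exp_add]; norm_num
  rw [Real.exp_neg, inv_le_comm₀ (Real.exp_pos _) (by norm_num), h3]
  calc (0.1695 : ℝ)⁻¹ ≤ 2.7182818283 * 2.1705 := by norm_num
    _ ≤ _ := by gcongr; linarith

lemma le_exp_neg_71_div_40 : 0.169 ≤ Real.exp (-(71 / 40)) := by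
  have h1 : Real.exp 1 < 2.7182818286 := Real.exp_one_lt_d9
  have h2 := Real.quadratic_le_exp_of_nonneg (x := 9 / 40) (by norm_num)
  have h3 : Real.exp (-(71 / 40)) * (Real.exp 1 * Real.exp 1) = Real.exp (9 / 40) := by
    rw [← Real.exp_add, ← Real.exp_add]; norm_num
  have h4 : Real.exp 1 * Real.exp 1 ≤ 7.39 := by nlinarith [Real.exp_pos 1]
  have h5 := Real.exp_pos (-(71 / 40))
  nlinarith

lemma le_exp_neg_781_div_200 : 0.02 ≤ Real.exp (-(781 / 200)) := by
  have h1 : Real.exp 1 < 2.7182818286 := Real.exp_one_lt_d9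
  have h2 := Real.quadratic_le_exp_of_nonneg (x := 19 / 200) (by norm_num)
  have h3 : Real.exp (-(781 / 200)) * (Real.exp 1) ^ 4 = Real.exp (19 / 200) := by
    rw [← Real.exp_nat_mul, ← Real.exp_add]; norm_num
  have h4 : Real.exp 1 ^ 4 ≤ 2.7182818286 ^ 4 := by
    have := Real.exp_pos 1
    gcongr
  have h5 := Real.exp_pos (-(781 / 200))
  nlinarith

/-- Here `m = M - 1`: one factor of `β ^ (-M)` is spent on the prefactor `β * C` of the new
potential. The rest is about `exp (-3.55 / 2)`, and 71/40 is 3.55/2. -/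
lemma inv_pow_le_exp {β ε : ℝ} {m : ℕ} (hε0 : 0 < ε) (hε1 : ε < 1)
    (hβ : β = (1 - ε / 2) / (1 - ε)) (hm : 3.55 / ε < (m : ℝ) + 1) :
    (β⁻¹) ^ m ≤ 0.1695 := by
  have h2 : 0 < 1 - ε / 2 := by linarith
  have hb : β⁻¹ = (1 - ε) / (1 - ε / 2) := by rw [hβ, inv_div]
  have hb0 : 0 ≤ β⁻¹ := by rw [hb]; exact div_nonneg (by linarith) h2.le
  have h3 : 3.55 < ((m : ℝ) + 1) * ε := by rwa [div_lt_iff₀ hε0] at hm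
  have h4 : (m : ℝ) * (β⁻¹ - 1) ≤ -(71 / 40) := by
    have : β⁻¹ - 1 = -(ε / 2) / (1 - ε / 2) := by
      rw [hb, eq_div_iff h2.ne', sub_mul, div_mul_cancel₀ _ h2.ne']; ring
    rw [this, mul_div_assoc', div_le_iff₀ h2]
    nlinarith
  calc (β⁻¹) ^ m ≤ Real.exp (β⁻¹ - 1) ^ m := by
        gcongr
        linarith [Real.add_one_le_exp (β⁻¹ - 1)]
    _ = Real.exp (m * (β⁻¹ - 1)) := (Real.exp_nat_mul _ _).symm
    _ ≤ Real.exp (-(71 / 40)) := Real.exp_le_exp.2 h4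
    _ ≤ _ := exp_neg_71_div_40_le

lemma le_pow_of_near {ε r : ℝ} {M : ℕ} (hε0 : 0 < ε) (hε1 : ε ≤ 0.1) (hr : 1 - 1.1 * ε ≤ r)
    (hM : ε * M ≤ 3.55 + ε) : 0.02 * (1 - 6.1 * ε) ≤ r ^ M := by
  have h0 : 0 < 1 - 1.1 * ε := by linarith
  have h1 : Real.exp (1 - (1 - 1.1 * ε)⁻¹) ≤ 1 - 1.1 * ε := by
    have := Real.one_sub_inv_le_log_of_pos h0
    rwa [Real.le_log_iff_exp_le h0] at this
  -- 781/200 is 1.1 * 3.55; the slope 6.1 absorbs the second-order terms for `ε ≤ 0.1`.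
  have h2 : -(781 / 200) + -(6.1 * ε) ≤ M * (1 - (1 - 1.1 * ε)⁻¹) := by
    have : 1 - (1 - 1.1 * ε)⁻¹ = -(1.1 * ε) / (1 - 1.1 * ε) := by field_simp; ring
    rw [this, mul_div_assoc', le_div_iff₀ h0]
    nlinarith
  calc 0.02 * (1 - 6.1 * ε) ≤ Real.exp (-(781 / 200)) * Real.exp (-(6.1 * ε)) := by
        have := Real.add_one_le_exp (-(6.1 * ε))
        exact mul_le_mul le_exp_neg_781_div_200 (by linarith) (by linarith) (Real.exp_pos _).le
    _ = Real.exp (-(781 / 200) + -(6.1 * ε)) := (Real.exp_add _ _).symm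
    _ ≤ Real.exp (M * (1 - (1 - 1.1 * ε)⁻¹)) := Real.exp_le_exp.2 h2
    _ = Real.exp (1 - (1 - 1.1 * ε)⁻¹) ^ M := Real.exp_nat_mul _ _
    _ ≤ (1 - 1.1 * ε) ^ M := by gcongr
    _ ≤ r ^ M := by gcongr

/-- The part of the boundary inequality that does not involve the power `r ^ M`. -/
lemma boundary_main_term {ε s m a k A B : ℝ} (hs0 : 0 ≤ s)
    (hs1 : s ≤ 1) (hm1 : m ≤ 3.55 + ε) (ha : a ≤ 0.1695)
    (hk0 : 0 ≤ k) (hk : k ≤ 1 + s) (hA : A = 5.5 * (1 + ε) + 2 * s / (1 + s))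
    (hB0 : m ≤ B) (hB : B ≤ 5.5 * (2 + ε) + 2 * s) :
    1.95 + 2 * s / (1 + s) + 4.5 * ε - 0.1695 * (1 + s) * (7.45 + 2 * s + 4.5 * ε)
      ≤ A - m - a * k * (B - m) := by
  have h1 : a * k * (B - m) ≤ 0.1695 * (1 + s) * (5.5 * (2 + ε) + 2 * s - m) := by
    gcongr
  nlinarith

lemma main_term_nonneg_of_le {s ε : ℝ} (hs0 : 0 ≤ s) (hs1 : s ≤ 5 / 6) (hε : 0 ≤ ε) :
    0 ≤ 1.95 + 2 * s / (1 + s) + 4.5 * ε - 0.1695 * (1 + s) * (7.45 + 2 * s + 4.5 * ε) := by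
  -- 12/11 is the value of `2 / (1 + s)` at `s = 5 / 6`.
  have h1 : 12 / 11 * s ≤ 2 * s / (1 + s) := by
    rw [le_div_iff₀ (by linarith)]; nlinarith
  nlinarith [mul_nonneg hs0 (sub_nonneg.2 hs1), mul_nonneg hε (sub_nonneg.2 hs1)]

lemma le_main_term {s ε : ℝ} (hs0 : 0 ≤ s) (hs1 : s ≤ 1) (hε : 0 ≤ ε) :
    -0.2536 + 2.97 * ε ≤
      1.95 + 2 * s / (1 + s) + 4.5 * ε - 0.1695 * (1 + s) * (7.45 + 2 * s + 4.5 * ε) := by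
  have h1 : s ≤ 2 * s / (1 + s) := by
    rw [le_div_iff₀ (by linarith)]; nlinarith
  nlinarith [mul_nonneg hs0 (sub_nonneg.2 hs1), mul_nonneg hε (sub_nonneg.2 hs1)]

/-- This is the boundary inequality multiplied by `ε * δ / C`, with `m = ε * M`, `a = β⁻¹ ^ (M -
1)`, `z = r ^ M`. The coefficient of `z` is nonnegative, so `z` can be dropped except when `ε` is
small and `δ` is close to `ε`. -/
lemma boundary_core {ε δ δ' m a β z A B : ℝ} (hε0 : 0 < ε) (hε1 : ε < 1) (hδ : ε ≤ δ) (hδ1 : δ ≤ 1)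
    (hδ' : δ' = δ - ε / 2 * ((1 - δ) / (1 - ε)))
    (hm1 : m ≤ 3.55 + ε) (ha : a ≤ 0.1695) (hβ : 1 ≤ β) (hz0 : 0 ≤ z)
    (hz : ε ≤ 0.1 → δ ≤ 1.1 * ε → 0.02 * (1 - 6.1 * ε) ≤ z)
    (hA : A = 5.5 * (1 + ε) + ε / δ) (hB : B = 5.5 * (2 + ε) + ε / δ') :
    0 ≤ A - m - a * (δ / δ') * (B - m) + z * (δ / δ' * β * B - A) := by
  have hδ0 : 0 < δ := by linarith
  have hq1 : (1 - δ) / (1 - ε) ≤ 1 := by rw [div_le_one (by linarith)]; linarith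
  have hq0 : 0 ≤ (1 - δ) / (1 - ε) := div_nonneg (by linarith) (by linarith)
  have hδ'1 : δ - ε / 2 ≤ δ' := by rw [hδ']; nlinarith
  have hδ'2 : δ' ≤ δ := by rw [hδ']; nlinarith
  have hδ'0 : 0 < δ' := by linarith
  have h2 : 0 < 2 * δ - ε := by linarith
  -- Since `δ' ≥ δ - ε / 2`, all ratios are controlled by `s`, which reaches 1 exactly when `δ = ε`.
  set s := ε / (2 * δ - ε) with hs
  have hs0 : 0 < s := by positivity
  have hs1 : s ≤ 1 := by rw [hs, div_le_one h2]; linarith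
  have hk1 : 1 ≤ δ / δ' := by rwa [one_le_div hδ'0]
  have hk : δ / δ' ≤ 1 + s := by
    rw [div_le_iff₀ hδ'0, hs, one_add_div h2.ne', div_mul_eq_mul_div, le_div_iff₀ h2]
    nlinarith
  have hed : ε / δ = 2 * s / (1 + s) := by
    have : s * (2 * δ - ε) = ε := div_mul_cancel₀ _ h2.ne'
    rw [div_eq_div_iff hδ0.ne' (by positivity)]
    linear_combination -this
  have hed' : ε / δ' ≤ 2 * s := by
    rw [div_le_iff₀ hδ'0, hs, mul_div_assoc', div_mul_eq_mul_div, le_div_iff₀ h2]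
    nlinarith
  have hed'0 : ε / δ ≤ ε / δ' := by gcongr
  have hed0 : 0 ≤ ε / δ := by positivity
  have hmain := boundary_main_term hs0.le hs1 hm1 ha (by linarith) hk
    (hed ▸ hA) (B := B) (by rw [hB]; linarith) (by linarith)
  have hkβ : δ / δ' ≤ δ / δ' * β := le_mul_of_one_le_right (by linarith) hβ
  have hB0 : 0 ≤ B := by rw [hB]; linarith
  have hcoef : B * (δ / δ') - A ≤ δ / δ' * β * B - A := by
    have : δ / δ' * B ≤ δ / δ' * β * B := by gcongr
    linarith
  have hcoef0 : 0 ≤ δ / δ' * β * B - A := by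
    have : B * 1 ≤ B * (δ / δ') := by gcongr
    linarith
  have hle := le_main_term hs0.le hs1 hε0.le
  -- In the tight case the main term may drop to about -0.2536, and the `z` term contributes at
  -- least `0.28 * (1 - 6.1 * ε)`. Otherwise `ε > 0.1`, or `δ > 1.1 * ε`, which forces `s ≤ 5 / 6`.
  by_cases hcase : ε ≤ 0.1 ∧ δ ≤ 1.1 * ε
  · obtain ⟨c1, c2⟩ := hcase
    have hz' := hz c1 c2
    have hq2 : 0.89 ≤ (1 - δ) / (1 - ε) := by
      rw [le_div_iff₀ (by linarith)]; linarith
    have hδ'3 : δ' ≤ δ - 0.445 * ε := by rw [hδ']; nlinarith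
    have hk2 : 1.67 ≤ δ / δ' := by rw [le_div_iff₀ hδ'0]; linarith
    have he2 : 1.5 ≤ ε / δ' := by rw [le_div_iff₀ hδ'0]; linarith
    have he3 : ε / δ ≤ 1 := by rw [div_le_one hδ0]; exact hδ
    have hB2 : 12.5 + 5.5 * ε ≤ B := by rw [hB]; linarith
    have hc2 : 14 ≤ δ / δ' * β * B - A := by
      have : (12.5 + 5.5 * ε) * 1.67 ≤ B * (δ / δ') := by gcongr
      linarith
    have h5 : 0.02 * (1 - 6.1 * ε) * 14 ≤ z * (δ / δ' * β * B - A) :=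
      mul_le_mul hz' hc2 (by norm_num) hz0
    linarith
  · have h5 : 0 ≤ z * (δ / δ' * β * B - A) := mul_nonneg hz0 hcoef0
    rcases not_and_or.1 hcase with c | c
    · linarith
    · have hs3 : s ≤ 5 / 6 := by rw [hs, div_le_iff₀ h2]; linarith
      linarith [main_term_nonneg_of_le hs0.le hs3 hε0.le]

/-! ### The potential: boundary, positivity, harmonicity. -/

/-- The potential that dominates the expected number of flips of `BF2(C, i, ε)`. -/
noncomputable def bfPotential (p C : ℝ) (i : ℕ) (ε : ℝ) : ℝ :=
  C * ((5.5 * (1 + 1 / ε) / (1 - C * p) + 1 / (1 - C * p) ^ 2) * (1 - (C * p) ^ i)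
    - i / (1 - C * p))

lemma bfPotential_boundary {p C ε β : ℝ} {M : ℕ} (hp : 0 ≤ p) (hC : 0 < C) (hε0 : 0 < ε)
    (hε1 : ε < 1) (hCp : C * p ≤ 1 - ε) (hβ : β = (1 - ε / 2) / (1 - ε))
    (hM : 3.55 / ε < (M : ℝ)) (hM' : (M : ℝ) ≤ 3.55 / ε + 1) :
    β ^ (-(M : ℤ)) * bfPotential p (β * C) M (ε / 2) ≤ bfPotential p C M ε := by
  obtain ⟨m, rfl⟩ : ∃ m, M = m + 1 := by
    refine Nat.exists_eq_succ_of_ne_zero fun h => ?_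
    have : 0 < 3.55 / ε := by positivity
    rw [h] at hM
    norm_num at hM
    linarith
  have h1ε : 0 < 1 - ε := by linarith
  have hβ1 : 1 ≤ β := by rw [hβ, one_le_div h1ε]; linarith
  have hβ0 : 0 < β := by linarith
  have hr0 : 0 ≤ C * p := by positivity
  have ha := inv_pow_le_exp hε0 hε1 hβ (m := m) (by exact_mod_cast hM)
  have hmM : ε * ((m + 1 : ℕ) : ℝ) ≤ 3.55 + ε := by
    calc ε * ((m + 1 : ℕ) : ℝ) ≤ ε * (3.55 / ε + 1) := by gcongr
      _ = _ := by field_simp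
  set δ := 1 - C * p with hδ
  have hδε : ε ≤ δ := by linarith
  have hδ0 : 0 < δ := by linarith
  set δ' := 1 - β * C * p with hδ'
  have hδδ' : δ' = δ - ε / 2 * ((1 - δ) / (1 - ε)) := by
    rw [hδ', hδ, hβ]; field_simp; ring
  have hδ'0 : 0 < δ' := by
    have hq1 : (1 - δ) / (1 - ε) ≤ 1 := by rw [div_le_one (by linarith)]; linarith
    rw [hδδ']; nlinarith
  have key := boundary_core (m := ε * ((m + 1 : ℕ) : ℝ)) (a := β⁻¹ ^ m) (z := (C * p) ^ (m + 1))
    hε0 hε1 hδε (by linarith) hδδ' hmM ha hβ1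
    (by positivity) (fun h1 h2 => le_pow_of_near hε0 h1 (by linarith) hmM) rfl rfl
  have hpow : (β * C * p) ^ (m + 1) = β ^ (m + 1) * (C * p) ^ (m + 1) := by
    rw [mul_assoc, mul_pow]
  have hzp : β ^ (-((m + 1 : ℕ) : ℤ)) = β⁻¹ ^ m * β⁻¹ := by
    rw [zpow_neg, zpow_natCast, ← inv_pow, pow_succ]
  have hbb : β⁻¹ ^ m * β ^ m = 1 := by rw [← mul_pow, inv_mul_cancel₀ hβ0.ne', one_pow]
  rw [← sub_nonneg]
  unfold bfPotential
  rw [← hδ, ← hδ', hpow, hzp]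
  generalize hMr : ((m + 1 : ℕ) : ℝ) = M at *
  generalize (C * p) ^ (m + 1) = z at *
  have hab : β⁻¹ ^ m * β⁻¹ * (β * C) = β⁻¹ ^ m * C := by field_simp
  rw [← mul_assoc, hab, pow_succ β]
  generalize β⁻¹ ^ m = a at *
  generalize β ^ m = b at *
  have hb : b = a⁻¹ := eq_inv_of_mul_eq_one_right hbb
  have ha0 : a ≠ 0 := left_ne_zero_of_mul_eq_one hbb
  -- The difference of potentials is `C / (ε * δ)` times the quantity in `key`.
  have e : ∀ x y : ℝ, x = C / (ε * δ) * y → 0 ≤ y → 0 ≤ x := fun x y h hy => by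
    rw [h]; positivity
  refine e _ _ ?_ key
  subst hb
  clear_value δ δ'
  field_simp
  ring

/-- Nonnegativity lets `ENNReal.ofReal` split over sums in `bfMean_le`. By Bernoulli's inequality,
`(1 - δ) ^ i * (1 + i * δ) ≤ 1`, which reduces the claim to `i ≤ 5.5 * (1 + 1 / ε)`. -/
lemma bfPotential_nonneg {p C ε : ℝ} {i : ℕ} (hp : 0 ≤ p) (hC : 0 < C) (hε0 : 0 < ε)
    (hCp : C * p ≤ 1 - ε) (hi : (i : ℝ) ≤ 3.55 / ε + 1) : 0 ≤ bfPotential p C i ε := by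
  have hr0 : 0 ≤ C * p := by positivity
  unfold bfPotential
  set δ := 1 - C * p with hδ
  have hδ0 : 0 < δ := by linarith
  have hr : C * p = 1 - δ := by rw [hδ]; ring
  rw [hr] at hr0 ⊢
  have h1 : (1 - δ) ^ i ≤ 1 / (1 + i * δ) := by
    rw [le_div_iff₀ (by positivity)]
    calc (1 - δ) ^ i * (1 + i * δ) ≤ (1 - δ) ^ i * (1 + δ) ^ i := by
          gcongr
          exact one_add_mul_le_pow (by linarith) i
      _ = ((1 - δ) * (1 + δ)) ^ i := (mul_pow _ _ _).symm
      _ ≤ 1 := pow_le_one₀ (by nlinarith) (by nlinarith)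
  have h2 : i * δ / (1 + i * δ) ≤ 1 - (1 - δ) ^ i := by
    have : i * δ / (1 + i * δ) = 1 - 1 / (1 + i * δ) := by field_simp; ring
    linarith
  have h3 : (1 + i * δ) / δ ^ 2 ≤ 5.5 * (1 + 1 / ε) / δ + 1 / δ ^ 2 := by
    have : 5.5 * (1 + 1 / ε) / δ + 1 / δ ^ 2 = (1 + (5.5 * (1 + 1 / ε)) * δ) / δ ^ 2 := by
      field_simp; ring
    rw [this]
    gcongr
    have h4 : 3.55 / ε = 3.55 * (1 / ε) := by ring
    have h5 : 0 < 1 / ε := by positivity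
    linarith
  have h6 : (i : ℝ) / δ = (1 + i * δ) / δ ^ 2 * (i * δ / (1 + i * δ)) := by
    field_simp
  refine mul_nonneg hC.le (sub_nonneg.2 ?_)
  rw [h6]
  gcongr

lemma bfPotential_harmonic {p C : ℝ} {i : ℕ} (ε : ℝ) (hC : 0 < C)
    (hCp : C * p < 1) (hi : i ≠ 0) :
    C / (1 + C) * (p * (1 + bfPotential p C (i - 1) ε) + (1 - p) * (1 + bfPotential p C i ε))
      + (1 - C / (1 + C)) * bfPotential p C (i + 1) ε = bfPotential p C i ε := by
  obtain ⟨j, rfl⟩ := Nat.exists_eq_succ_of_ne_zero hi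
  have hδ : 1 - C * p ≠ 0 := by linarith
  have h1 : 1 + C ≠ 0 := by linarith
  unfold bfPotential
  generalize 5.5 * (1 + 1 / ε) = L
  simp only [Nat.succ_eq_add_one, Nat.add_sub_cancel, pow_succ]
  push_cast
  generalize hz : (C * p) ^ j = z
  field_simp
  ring

lemma bfPotential_one {p C ε : ℝ} (hε0 : 0 < ε)
    (hCp : C * p ≤ 1 - ε) : bfPotential p C 1 ε = 5.5 * C * (1 + ε⁻¹) := by
  have hδ : 1 - C * p ≠ 0 := by linarith
  unfold bfPotential
  field_simp
  push_cast
  ring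

lemma bound_constants :
    5.5 ≤ 3.55 / ((1 - Real.exp (-3.55)) * (1 - 2 * Real.exp (-3.55 / 2))) ∧
      3.55 / ((1 - Real.exp (-3.55)) * (1 - 2 * Real.exp (-3.55 / 2))) ≤ 5.53 := by
  have h1 : (-3.55 / 2 : ℝ) = -(71 / 40) := by norm_num
  have h2 : Real.exp (-3.55) = Real.exp (-(71 / 40)) ^ 2 := by
    rw [← Real.exp_nat_mul]; norm_num
  rw [h1, h2]
  have h3 := exp_neg_71_div_40_le
  have h4 := le_exp_neg_71_div_40
  generalize Real.exp (-(71 / 40)) = b at *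
  have h5 : (1 - 0.1695 ^ 2) * (1 - 2 * 0.1695) ≤ (1 - b ^ 2) * (1 - 2 * b) := by
    apply mul_le_mul <;> nlinarith
  have h6 : (1 - b ^ 2) * (1 - 2 * b) ≤ (1 - 0.169 ^ 2) * (1 - 2 * 0.169) := by
    apply mul_le_mul <;> nlinarith
  have h7 : 0 < (1 - b ^ 2) * (1 - 2 * b) := by norm_num at h5; linarith
  constructor
  · rw [le_div_iff₀ h7]; norm_num at h6; linarith
  · rw [div_le_iff₀ h7]; norm_num at h5; linarith

/-! ### Splitting off the head of an i.i.d. sequence. -/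

section HeadTail

variable {α : Type*} [MeasurableSpace α] (κ : Measure α) [IsProbabilityMeasure κ]

/-- The head and the tail of an i.i.d. sequence are independent. -/
lemma measurePreserving_head_tail :
    MeasurePreserving (fun u : ℕ → α => (u 0, fun k => u (k + 1)))
      (Measure.infinitePi fun _ : ℕ => κ) (κ.prod (Measure.infinitePi fun _ : ℕ => κ)) := by
  classical
  have hT : Measurable (fun u : ℕ → α => (u 0, fun k => u (k + 1))) := by fun_prop
  let c : α × (ℕ → α) → ℕ → α := fun q n => Nat.casesOn n q.1 q.2
  have hc : Measurable c := by
    refine measurable_pi_lambda _ fun n => ?_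
    cases n with
    | zero => exact measurable_fst
    | succ k => exact (measurable_pi_apply k).comp measurable_snd
  have hmap : (κ.prod (Measure.infinitePi fun _ : ℕ => κ)).map c
      = Measure.infinitePi fun _ : ℕ => κ := by
    refine Measure.eq_infinitePi _ fun s t ht => ?_
    obtain ⟨N, hN⟩ : ∃ N, ∀ i ∈ s, i < N + 1 :=
      ⟨s.sup id, fun i hi => Nat.lt_succ_of_le (Finset.le_sup (f := id) hi)⟩
    -- Padding with `Set.univ` turns the cylinder over `s` into one over an initial segment, which
    -- splits at index 0.
    let t' : ℕ → Set α := fun i => if i ∈ s then t i else Set.univ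
    have ht' : ∀ i, MeasurableSet (t' i) := fun i => by
      dsimp only [t']; split_ifs
      exacts [ht i, .univ]
    have hpre : c ⁻¹' (Set.pi s t)
        = t' 0 ×ˢ Set.pi (Finset.range N : Set ℕ) (fun i => t' (i + 1)) := by
      ext q
      simp only [Set.mem_preimage, Set.mem_pi, Set.mem_prod, t', Finset.mem_coe, Finset.mem_range]
      constructor
      · intro h
        refine ⟨?_, fun i _ => ?_⟩
        · split_ifs with h0
          exacts [h 0 h0, trivial]
        · split_ifs with h0
          exacts [h (i + 1) h0, trivial]
      · rintro ⟨h0, h1⟩ i hi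
        cases i with
        | zero => rw [if_pos hi] at h0; exact h0
        | succ k =>
          have h2 := h1 k (Nat.lt_of_succ_lt_succ (hN _ hi))
          rw [if_pos hi] at h2
          exact h2
    rw [Measure.map_apply hc (.pi s.countable_toSet fun i _ => ht i), hpre, Measure.prod_prod,
      Measure.infinitePi_pi _ fun i _ => ht' _]
    calc κ (t' 0) * ∏ i ∈ Finset.range N, κ (t' (i + 1))
        = ∏ i ∈ Finset.range (N + 1), κ (t' i) := by rw [Finset.prod_range_succ', mul_comm]
      _ = ∏ i ∈ s, κ (t' i) := by
          refine (Finset.prod_subset (fun i hi => Finset.mem_range.2 (hN i hi)) ?_).symm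
          intro i _ hi
          simp [t', hi]
      _ = ∏ i ∈ s, κ (t i) := Finset.prod_congr rfl fun i hi => by simp [t', hi]
  refine ⟨hT, ?_⟩
  conv_lhs => rw [← hmap]
  rw [Measure.map_map hT hc]
  exact Measure.map_id

lemma lintegral_infinitePi_ite_head {P : α → Prop} [DecidablePred P]
    (hP : MeasurableSet {a | P a}) {F G : (ℕ → α) → ℝ≥0∞} (hF : Measurable F) (hG : Measurable G) :
    ∫⁻ u, (if P (u 0) then F (fun k => u (k + 1)) else G (fun k => u (k + 1)))
        ∂(Measure.infinitePi fun _ : ℕ => κ)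
      = κ {a | P a} * ∫⁻ u, F u ∂(Measure.infinitePi fun _ : ℕ => κ)
        + κ {a | ¬ P a} * ∫⁻ u, G u ∂(Measure.infinitePi fun _ : ℕ => κ) := by
  set π := Measure.infinitePi fun _ : ℕ => κ
  have hm : Measurable fun q : α × (ℕ → α) => if P q.1 then F q.2 else G q.2 :=
    Measurable.ite (measurable_fst hP) (hF.comp measurable_snd) (hG.comp measurable_snd)
  have h1 := (measurePreserving_head_tail κ).lintegral_comp hm
  dsimp only at h1
  rw [h1, lintegral_prod _ hm.aemeasurable]
  have h2 : ∀ a, ∫⁻ u, (if P a then F u else G u) ∂π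
      = {a | P a}.indicator (fun _ => ∫⁻ u, F u ∂π) a
        + {a | ¬ P a}.indicator (fun _ => ∫⁻ u, G u ∂π) a := by
    intro a
    by_cases h : P a <;> simp [h]
  refine (lintegral_congr h2).trans ?_
  rw [lintegral_add_left (measurable_const.indicator hP), lintegral_indicator_const hP,
    lintegral_indicator_const (s := {a | ¬ P a}) hP.compl, mul_comm, mul_comm (κ {a | ¬ P a})]

end HeadTail

/-! ### First-step recursion for the number of flips. -/

/-- The run of the algorithm from an arbitrary configuration. -/
noncomputable def bfRunFrom (s : BFConfig) (u : ℕ → ℝ) (x : ℕ → Bool) : ℕ → BFConfig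
  | 0 => s
  | n + 1 => bfStep (u n) (x (bfRunFrom s u x n).flips) (bfRunFrom s u x n)

lemma bfRun_eq_bfRunFrom (C : ℝ) (i : ℕ) (ε : ℝ) (u : ℕ → ℝ) (x : ℕ → Bool) (n : ℕ) :
    bfRun C i ε u x n = bfRunFrom ⟨.bf2 C i ε, 0⟩ u x n := by
  induction n with
  | zero => rfl
  | succ n ih => rw [bfRun, bfRunFrom, ih]

lemma bfRunFrom_succ (s : BFConfig) (u : ℕ → ℝ) (x : ℕ → Bool) (n : ℕ) :
    bfRunFrom s u x (n + 1)
      = bfRunFrom (bfStep (u 0) (x s.flips) s) (fun k => u (k + 1)) x n := by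
  induction n with
  | zero => rfl
  | succ n ih => rw [bfRunFrom, ih, bfRunFrom]

/-- The number of flips made in `n` steps from the control state `c`. -/
noncomputable def bfCount : ℕ → BFControl → (ℕ → ℝ) × (ℕ → Bool) → ℕ
  | 0, _, _ => 0
  | n + 1, c, q =>
    -- The auxiliary sequence always advances by one, the coin sequence only when a flip is used.
    (bfStep (q.1 0) (q.2 0) ⟨c, 0⟩).flips + bfCount n (bfStep (q.1 0) (q.2 0) ⟨c, 0⟩).ctrl
      (fun k => q.1 (k + 1), fun k => q.2 (k + (bfStep (q.1 0) (q.2 0) ⟨c, 0⟩).flips))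

lemma bfStep_eq_shift (u : ℝ) (x : Bool) (c : BFControl) (k : ℕ) :
    bfStep u x ⟨c, k⟩
      = ⟨(bfStep u x ⟨c, 0⟩).ctrl, k + (bfStep u x ⟨c, 0⟩).flips⟩ := by
  cases c with
  | ret b => rfl
  | bf2 C i ε => simp only [bfStep]; split_ifs <;> rfl
  | bf1 C i ε => simp only [bfStep]; split_ifs <;> rfl

lemma bfRunFrom_flips (c : BFControl) (k : ℕ) (u : ℕ → ℝ) (x : ℕ → Bool) (n : ℕ) :
    (bfRunFrom ⟨c, k⟩ u x n).flips = k + bfCount n c (u, fun j => x (j + k)) := by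
  induction n generalizing c k u with
  | zero => rfl
  | succ n ih =>
    rw [bfRunFrom_succ, bfStep_eq_shift, ih, bfCount]
    simp only [zero_add, add_assoc, add_comm k]

lemma bfRun_flips (C : ℝ) (i : ℕ) (ε : ℝ) (u : ℕ → ℝ) (x : ℕ → Bool) (n : ℕ) :
    (bfRun C i ε u x n).flips = bfCount n (.bf2 C i ε) (u, x) := by
  rw [bfRun_eq_bfRunFrom, bfRunFrom_flips, zero_add]
  rfl

lemma bfRun_flips_mono (C : ℝ) (i : ℕ) (ε : ℝ) (u : ℕ → ℝ) (x : ℕ → Bool) :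
    Monotone fun n => (bfRun C i ε u x n).flips := by
  refine monotone_nat_of_le_succ fun n => ?_
  rw [bfRun, bfStep_eq_shift]
  exact Nat.le_add_right _ _

lemma bfCount_ret (n : ℕ) (b : Bool) (q : (ℕ → ℝ) × (ℕ → Bool)) : bfCount n (.ret b) q = 0 := by
  induction n generalizing q with
  | zero => rfl
  | succ n ih => simp [bfCount, bfStep, ih]

lemma bfCount_bf2_zero (n : ℕ) (C ε : ℝ) (q : (ℕ → ℝ) × (ℕ → Bool)) :
    bfCount n (.bf2 C 0 ε) q = 0 := by
  cases n with
  | zero => rfl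
  | succ n => simp [bfCount, bfStep, bfCount_ret]

lemma bfCount_bf2_of_lt (n : ℕ) {C ε : ℝ} {i : ℕ} (hi : i ≠ 0) (h : 3.55 / ε < (i : ℝ))
    (q : (ℕ → ℝ) × (ℕ → Bool)) :
    bfCount (n + 1) (.bf2 C i ε) q
      = if q.1 0 < ((1 - ε / 2) / (1 - ε)) ^ (-(i : ℤ)) then
          bfCount n (.bf2 ((1 - ε / 2) / (1 - ε) * C) i (ε / 2)) (fun k => q.1 (k + 1), q.2)
        else 0 := by
  simp only [bfCount, bfStep, if_neg hi, if_pos h]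
  split_ifs
  · simp
  · simp [bfCount_ret]

lemma bfCount_bf2_of_le (n : ℕ) {C ε : ℝ} {i : ℕ} (hi : i ≠ 0) (h : (i : ℝ) ≤ 3.55 / ε)
    (q : (ℕ → ℝ) × (ℕ → Bool)) :
    bfCount (n + 1) (.bf2 C i ε) q = bfCount n (.bf1 C i ε) (fun k => q.1 (k + 1), q.2) := by
  simp [bfCount, bfStep, if_neg hi, if_neg h.not_gt]

lemma bfCount_bf1 (n : ℕ) (C ε : ℝ) (i : ℕ) (q : (ℕ → ℝ) × (ℕ → Bool)) :
    bfCount (n + 1) (.bf1 C i ε) q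
      = if q.1 0 < C / (1 + C) then
          if q.2 0 = true then
            1 + bfCount n (.bf2 C (i - 1) ε) (fun k => q.1 (k + 1), fun k => q.2 (k + 1))
          else 1 + bfCount n (.bf1 C i ε) (fun k => q.1 (k + 1), fun k => q.2 (k + 1))
        else bfCount n (.bf2 C (i + 1) ε) (fun k => q.1 (k + 1), q.2) := by
  simp only [bfCount, bfStep]
  split_ifs <;> simp

lemma measurable_bfCount (n : ℕ) (c : BFControl) : Measurable (bfCount n c) := by
  induction n generalizing c with
  | zero => exact measurable_const
  | succ n ih =>
    have hs : Measurable fun q : (ℕ → ℝ) × (ℕ → Bool) => ((fun k => q.1 (k + 1), q.2) :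
      (ℕ → ℝ) × (ℕ → Bool)) := by fun_prop
    have hs' : Measurable fun q : (ℕ → ℝ) × (ℕ → Bool) =>
      ((fun k => q.1 (k + 1), fun k => q.2 (k + 1)) : (ℕ → ℝ) × (ℕ → Bool)) := by fun_prop
    have hlt : ∀ t : ℝ, MeasurableSet {q : (ℕ → ℝ) × (ℕ → Bool) | q.1 0 < t} := fun t =>
      measurableSet_lt (by fun_prop) measurable_const
    have hx : MeasurableSet {q : (ℕ → ℝ) × (ℕ → Bool) | q.2 0 = true} :=
      (by fun_prop : Measurable fun q : (ℕ → ℝ) × (ℕ → Bool) => q.2 0) (measurableSet_singleton true)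
    cases c with
    | ret b => simp only [funext (bfCount_ret (n + 1) b), measurable_const]
    | bf2 C i ε =>
      rcases eq_or_ne i 0 with rfl | hi
      · simp only [funext (bfCount_bf2_zero (n + 1) C ε), measurable_const]
      · rcases lt_or_ge (3.55 / ε) (i : ℝ) with h | h
        · rw [funext (bfCount_bf2_of_lt n (C := C) hi h)]
          exact Measurable.ite (hlt _) ((ih _).comp hs) measurable_const
        · rw [funext (bfCount_bf2_of_le n (C := C) hi h)]
          exact (ih _).comp hs
    | bf1 C i ε =>
      rw [funext (bfCount_bf1 n C ε i)]
      exact Measurable.ite (hlt _)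
        (Measurable.ite hx (((ih _).comp hs').const_add 1) (((ih _).comp hs').const_add 1))
        ((ih _).comp hs)

/-! ### Expected flips in finitely many steps. -/

section Expectation

variable (κ : Measure ℝ) (b : Measure Bool) [IsProbabilityMeasure b]

/-- The joint law of the auxiliary randomness and the coin flips. -/
noncomputable def seedLaw : Measure ((ℕ → ℝ) × (ℕ → Bool)) :=
  (Measure.infinitePi fun _ : ℕ => κ).prod (Measure.infinitePi fun _ : ℕ => b)

instance [IsProbabilityMeasure κ] : IsProbabilityMeasure (seedLaw κ b) := by
  unfold seedLaw; infer_instance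

lemma lintegral_seedLaw_ite_snd {F G : (ℕ → ℝ) × (ℕ → Bool) → ℝ≥0∞}
    (hF : Measurable F) (hG : Measurable G) :
    ∫⁻ q, (if q.2 0 = true then F (q.1, fun k => q.2 (k + 1)) else G (q.1, fun k => q.2 (k + 1)))
        ∂(seedLaw κ b)
      = b {a | a = true} * ∫⁻ q, F q ∂(seedLaw κ b)
        + b {a | ¬ a = true} * ∫⁻ q, G q ∂(seedLaw κ b) := by
  have hs : Measurable fun q : (ℕ → ℝ) × (ℕ → Bool) => ((q.1, fun k => q.2 (k + 1)) :
    (ℕ → ℝ) × (ℕ → Bool)) := by fun_prop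
  have hx : MeasurableSet {q : (ℕ → ℝ) × (ℕ → Bool) | q.2 0 = true} :=
    (by fun_prop : Measurable fun q : (ℕ → ℝ) × (ℕ → Bool) => q.2 0) (measurableSet_singleton true)
  have hm : Measurable fun q : (ℕ → ℝ) × (ℕ → Bool) =>
      if q.2 0 = true then F (q.1, fun k => q.2 (k + 1)) else G (q.1, fun k => q.2 (k + 1)) :=
    Measurable.ite hx (hF.comp hs) (hG.comp hs)
  unfold seedLaw
  rw [lintegral_prod _ hm.aemeasurable, lintegral_prod _ hF.aemeasurable,
    lintegral_prod _ hG.aemeasurable,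
    ← lintegral_const_mul _ hF.lintegral_prod_right',
    ← lintegral_const_mul _ hG.lintegral_prod_right',
    ← lintegral_add_left (hF.lintegral_prod_right'.const_mul _)]
  refine lintegral_congr fun u => ?_
  exact lintegral_infinitePi_ite_head b (P := (· = true)) (measurableSet_singleton true)
    (F := fun x => F (u, x)) (G := fun x => G (u, x))
    (hF.comp measurable_prodMk_left) (hG.comp measurable_prodMk_left)

variable [IsProbabilityMeasure κ]

lemma lintegral_seedLaw_ite_fst (t : ℝ) {F G : (ℕ → ℝ) × (ℕ → Bool) → ℝ≥0∞}
    (hF : Measurable F) (hG : Measurable G) :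
    ∫⁻ q, (if q.1 0 < t then F (fun k => q.1 (k + 1), q.2) else G (fun k => q.1 (k + 1), q.2))
        ∂(seedLaw κ b)
      = κ {a | a < t} * ∫⁻ q, F q ∂(seedLaw κ b) + κ {a | ¬ a < t} * ∫⁻ q, G q ∂(seedLaw κ b) := by
  have hs : Measurable fun q : (ℕ → ℝ) × (ℕ → Bool) => ((fun k => q.1 (k + 1), q.2) :
    (ℕ → ℝ) × (ℕ → Bool)) := by fun_prop
  have hm : Measurable fun q : (ℕ → ℝ) × (ℕ → Bool) =>
      if q.1 0 < t then F (fun k => q.1 (k + 1), q.2) else G (fun k => q.1 (k + 1), q.2) :=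
    Measurable.ite (measurableSet_lt (by fun_prop) measurable_const) (hF.comp hs) (hG.comp hs)
  unfold seedLaw
  rw [lintegral_prod_symm' _ hm, lintegral_prod_symm' _ hF, lintegral_prod_symm' _ hG,
    ← lintegral_const_mul _ hF.lintegral_prod_left', ← lintegral_const_mul _ hG.lintegral_prod_left',
    ← lintegral_add_left (hF.lintegral_prod_left'.const_mul _)]
  refine lintegral_congr fun x => ?_
  exact lintegral_infinitePi_ite_head κ (P := (· < t)) measurableSet_Iio
    (F := fun u => F (u, x)) (G := fun u => G (u, x))
    (hF.comp measurable_prodMk_right) (hG.comp measurable_prodMk_right)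

lemma lintegral_seedLaw_tail_fst {F : (ℕ → ℝ) × (ℕ → Bool) → ℝ≥0∞} (hF : Measurable F) :
    ∫⁻ q, F (fun k => q.1 (k + 1), q.2) ∂(seedLaw κ b) = ∫⁻ q, F q ∂(seedLaw κ b) := by
  have h := lintegral_seedLaw_ite_fst κ b 0 hF hF
  have h1 : κ {a | a < 0} + κ {a | ¬ a < 0} = 1 :=
    prob_add_prob_compl (μ := κ) (s := Set.Iio (0 : ℝ)) measurableSet_Iio
  simpa [← add_mul, -not_lt, h1] using h

/-- The expected number of flips made in `n` steps from the control state `c`. -/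
noncomputable def bfMean (n : ℕ) (c : BFControl) : ℝ≥0∞ :=
  ∫⁻ q, (bfCount n c q : ℝ≥0∞) ∂(seedLaw κ b)

lemma measurable_coe_bfCount (n : ℕ) (c : BFControl) :
    Measurable fun q => (bfCount n c q : ℝ≥0∞) :=
  measurable_from_top.comp (measurable_bfCount n c)

lemma bfMean_bf2_zero (n : ℕ) (C ε : ℝ) : bfMean κ b n (.bf2 C 0 ε) = 0 := by
  simp [bfMean, bfCount_bf2_zero]

lemma bfMean_bf2_of_lt (n : ℕ) {C ε : ℝ} {i : ℕ} (hi : i ≠ 0) (h : 3.55 / ε < (i : ℝ)) :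
    bfMean κ b (n + 1) (.bf2 C i ε)
      = κ {a | a < ((1 - ε / 2) / (1 - ε)) ^ (-(i : ℤ))}
        * bfMean κ b n (.bf2 ((1 - ε / 2) / (1 - ε) * C) i (ε / 2)) := by
  have := lintegral_seedLaw_ite_fst κ b (((1 - ε / 2) / (1 - ε)) ^ (-(i : ℤ)))
    (measurable_coe_bfCount n (.bf2 ((1 - ε / 2) / (1 - ε) * C) i (ε / 2)))
    (measurable_const (a := (0 : ℝ≥0∞)))
  simp only [bfMean, bfCount_bf2_of_lt n hi h]
  push_cast
  rw [this]
  simp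

lemma bfMean_bf2_of_le (n : ℕ) {C ε : ℝ} {i : ℕ} (hi : i ≠ 0) (h : (i : ℝ) ≤ 3.55 / ε) :
    bfMean κ b (n + 1) (.bf2 C i ε) = bfMean κ b n (.bf1 C i ε) := by
  simp only [bfMean, bfCount_bf2_of_le n hi h]
  exact lintegral_seedLaw_tail_fst κ b (measurable_coe_bfCount n _)

lemma bfMean_bf1 (n : ℕ) (C ε : ℝ) (i : ℕ) :
    bfMean κ b (n + 1) (.bf1 C i ε)
      = κ {a | a < C / (1 + C)} * (b {a | a = true} * (1 + bfMean κ b n (.bf2 C (i - 1) ε))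
          + b {a | ¬ a = true} * (1 + bfMean κ b n (.bf1 C i ε)))
        + κ {a | ¬ a < C / (1 + C)} * bfMean κ b n (.bf2 C (i + 1) ε) := by
  have hone : ∀ c, ∫⁻ q, (1 + (bfCount n c q : ℝ≥0∞)) ∂(seedLaw κ b) = 1 + bfMean κ b n c := by
    intro c
    rw [lintegral_add_left measurable_const, lintegral_const, measure_univ, mul_one, bfMean]
  have h1 := (measurable_coe_bfCount n (.bf2 C (i - 1) ε)).const_add 1
  have h2 := (measurable_coe_bfCount n (.bf1 C i ε)).const_add 1
  have hs : Measurable fun q : (ℕ → ℝ) × (ℕ → Bool) => ((q.1, fun k => q.2 (k + 1)) :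
    (ℕ → ℝ) × (ℕ → Bool)) := by fun_prop
  have hx : MeasurableSet {q : (ℕ → ℝ) × (ℕ → Bool) | q.2 0 = true} :=
    (by fun_prop : Measurable fun q : (ℕ → ℝ) × (ℕ → Bool) => q.2 0) (measurableSet_singleton true)
  rw [← hone, ← hone, ← lintegral_seedLaw_ite_snd κ b h1 h2]
  refine Eq.trans (lintegral_congr fun q => ?_)
    (lintegral_seedLaw_ite_fst κ b (C / (1 + C)) (Measurable.ite hx (h1.comp hs) (h2.comp hs))
      (measurable_coe_bfCount n (.bf2 C (i + 1) ε)))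
  rw [bfCount_bf1]
  push_cast
  rfl

/-- The range `i ≤ 3.55 / ε + 1` is invariant: the walk overshoots the threshold by at most one, and
halving `ε` raises the threshold. BF1 states share the potential of BF2 because entering BF1 costs
no flip. -/
lemma bfMean_le {p : ℝ} (hp0 : 0 ≤ p) (hp1 : p ≤ 1)
    (hκ : ∀ t, 0 ≤ t → t ≤ 1 → κ {a | a < t} = ENNReal.ofReal t)
    (hb : b {a | a = true} = ENNReal.ofReal p) (n : ℕ) :
    ∀ (C ε : ℝ) (i : ℕ), 0 < C → 0 < ε → ε < 1 → C * p ≤ 1 - ε →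
      ((i : ℝ) ≤ 3.55 / ε + 1 →
        bfMean κ b n (.bf2 C i ε) ≤ ENNReal.ofReal (bfPotential p C i ε)) ∧
      (i ≠ 0 → (i : ℝ) ≤ 3.55 / ε →
        bfMean κ b n (.bf1 C i ε) ≤ ENNReal.ofReal (bfPotential p C i ε)) := by
  have hκ' : ∀ t, 0 ≤ t → t ≤ 1 → κ {a | ¬ a < t} = ENNReal.ofReal (1 - t) := by
    intro t h0 h1
    have := prob_compl_eq_one_sub (μ := κ) (s := Set.Iio t) measurableSet_Iio
    rw [ENNReal.ofReal_sub _ h0, ENNReal.ofReal_one, ← hκ t h0 h1]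
    exact this
  have hb' : b {a | ¬ a = true} = ENNReal.ofReal (1 - p) := by
    have := prob_compl_eq_one_sub (μ := b) (s := {true}) (measurableSet_singleton true)
    rw [ENNReal.ofReal_sub _ hp0, ENNReal.ofReal_one, ← hb]
    exact this
  induction n with
  | zero => intros; simp [bfMean, bfCount]
  | succ n ih =>
    intro C ε i hC hε0 hε1 hCp
    refine ⟨fun hi => ?_, fun hi0 hi => ?_⟩
    · rcases eq_or_ne i 0 with rfl | hi0
      · simp [bfMean_bf2_zero]
      rcases lt_or_ge (3.55 / ε) (i : ℝ) with h | h
      · rw [bfMean_bf2_of_lt κ b n hi0 h]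
        set β := (1 - ε / 2) / (1 - ε) with hβ
        have h1ε : 0 < 1 - ε := by linarith
        have hβ1 : 1 ≤ β := by rw [hβ, one_le_div h1ε]; linarith
        have ht0 : 0 ≤ β ^ (-(i : ℤ)) := by positivity
        have ht1 : β ^ (-(i : ℤ)) ≤ 1 := zpow_le_one_of_nonpos₀ hβ1 (by simp)
        have hCp' : β * C * p ≤ 1 - ε / 2 := by
          calc β * C * p = β * (C * p) := mul_assoc _ _ _
            _ ≤ β * (1 - ε) := by gcongr
            _ = _ := div_mul_cancel₀ _ h1ε.ne'
        have hi' : (i : ℝ) ≤ 3.55 / (ε / 2) + 1 := by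
          have : 3.55 / ε ≤ 3.55 / (ε / 2) := by gcongr; linarith
          linarith
        have := (ih (β * C) (ε / 2) i (by positivity) (by linarith) (by linarith) hCp').1 hi'
        rw [hκ _ ht0 ht1]
        calc _ ≤ ENNReal.ofReal (β ^ (-(i : ℤ))) * ENNReal.ofReal (bfPotential p (β * C) i (ε / 2)) :=
              by gcongr
          _ = ENNReal.ofReal (β ^ (-(i : ℤ)) * bfPotential p (β * C) i (ε / 2)) :=
              (ENNReal.ofReal_mul ht0).symm
          _ ≤ _ := ENNReal.ofReal_le_ofReal (bfPotential_boundary hp0 hC hε0 hε1 hCp hβ h hi)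
      · rw [bfMean_bf2_of_le κ b n hi0 h]
        exact (ih C ε i hC hε0 hε1 hCp).2 hi0 h
    · have hq0 : 0 ≤ C / (1 + C) := by positivity
      have hq1 : C / (1 + C) ≤ 1 := by rw [div_le_one (by linarith)]; linarith
      have hd : ((i - 1 : ℕ) : ℝ) ≤ 3.55 / ε + 1 := by
        have : ((i - 1 : ℕ) : ℝ) ≤ i := by exact_mod_cast Nat.sub_le i 1
        linarith
      have hu : ((i + 1 : ℕ) : ℝ) ≤ 3.55 / ε + 1 := by push_cast; linarith
      have i1 := (ih C ε (i - 1) hC hε0 hε1 hCp).1 hd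
      have i2 := (ih C ε i hC hε0 hε1 hCp).2 hi0 hi
      have i3 := (ih C ε (i + 1) hC hε0 hε1 hCp).1 hu
      have p1 := bfPotential_nonneg hp0 hC hε0 hCp hd
      have p2 := bfPotential_nonneg hp0 hC hε0 hCp (i := i) (by linarith)
      have p3 := bfPotential_nonneg hp0 hC hε0 hCp hu
      rw [bfMean_bf1, hκ _ hq0 hq1, hκ' _ hq0 hq1, hb, hb',
        ← bfPotential_harmonic ε hC (by linarith) hi0]
      have hp1' : 0 ≤ 1 - p := by linarith
      have hq1' : 0 ≤ 1 - C / (1 + C) := by linarith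
      rw [ENNReal.ofReal_add (by positivity) (by positivity), ENNReal.ofReal_mul hq0,
        ENNReal.ofReal_mul hq1', ENNReal.ofReal_add (by positivity) (by positivity),
        ENNReal.ofReal_mul hp0, ENNReal.ofReal_mul hp1', ENNReal.ofReal_add zero_le_one p1,
        ENNReal.ofReal_add zero_le_one p2, ENNReal.ofReal_one]
      gcongr

end Expectation

/-! ### Transfer to the given random variables. -/

lemma uniform_measure_lt {Ω : Type*} [MeasurableSpace Ω] {μ : Measure Ω} {V : Ω → ℝ}
    (hV : pdf.IsUniform V (Set.Icc (0 : ℝ) 1) μ) {t : ℝ} (ht1 : t ≤ 1) :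
    μ.map V {a | a < t} = ENNReal.ofReal t := by
  have h : Set.Icc (0 : ℝ) 1 ∩ {a | a < t} = Set.Ico 0 t := by
    ext a
    simp only [Set.mem_inter_iff, Set.mem_Icc, Set.mem_ofPred_eq, Set.mem_Ico]
    exact ⟨fun h => ⟨h.1.1, h.2⟩, fun h => ⟨⟨h.1, by linarith [h.2]⟩, h.2⟩⟩
  rw [hV, cond_apply measurableSet_Icc, h]
  simp

lemma measure_bool_ext {ν ν' : Measure Bool} [IsProbabilityMeasure ν] [IsProbabilityMeasure ν']
    (h : ν {true} = ν' {true}) : ν = ν' := by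
  refine Measure.ext_of_singleton fun a => ?_
  cases a with
  | true => exact h
  | false =>
    have e : ({false} : Set Bool) = {true}ᶜ := by ext a; simp
    rw [e, prob_compl_eq_one_sub (measurableSet_singleton _),
      prob_compl_eq_one_sub (measurableSet_singleton _), h]

theorem mainTheorem2 {Ω : Type*} [MeasurableSpace Ω] (μ : Measure Ω) [IsProbabilityMeasure μ]
    (C p ε : ℝ) (hC : 1 ≤ C) (hp0 : 0 ≤ p) (hp1 : p ≤ 1) (hε0 : 0 < ε) (hε1 : ε < 1)
    (hCp : C * p ≤ 1 - ε)
    (U : ℕ → Ω → ℝ) (X : ℕ → Ω → Bool)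
    (hUm : ∀ n, Measurable (U n)) (hXm : ∀ n, Measurable (X n))
    (hU : ∀ n, pdf.IsUniform (U n) (Set.Icc (0 : ℝ) 1) μ)
    (hX : ∀ n, μ {ω | X n ω = true} = ENNReal.ofReal p)
    (hUi : iIndepFun U μ) (hXi : iIndepFun X μ)
    (hUX : IndepFun (fun ω n => U n ω) (fun ω n => X n ω) μ) :
    ∫⁻ ω, bfDraws C 1 ε (fun n => U n ω) (fun n => X n ω) ∂μ
        ≤ ENNReal.ofReal (3.55 * C * (1 + ε⁻¹) /
            ((1 - Real.exp (-3.55)) * (1 - 2 * Real.exp (-3.55 / 2)))) ∧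
      3.55 * C * (1 + ε⁻¹) / ((1 - Real.exp (-3.55)) * (1 - 2 * Real.exp (-3.55 / 2)))
        ≤ 5.53 * C * (1 + ε⁻¹) := by
  have hC0 : 0 < C := by linarith
  have hK : 0 ≤ C * (1 + ε⁻¹) := by positivity
  obtain ⟨hlow, hupp⟩ := bound_constants
  have hform : 3.55 * C * (1 + ε⁻¹) / ((1 - Real.exp (-3.55)) * (1 - 2 * Real.exp (-3.55 / 2)))
      = 3.55 / ((1 - Real.exp (-3.55)) * (1 - 2 * Real.exp (-3.55 / 2))) * (C * (1 + ε⁻¹)) := by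
    ring
  rw [hform]
  refine ⟨?_, by nlinarith⟩
  have hXt : ∀ n, μ.map (X n) {true} = ENNReal.ofReal p := fun n => by
    rw [Measure.map_apply (hXm n) (measurableSet_singleton _)]
    exact hX n
  have hprU : ∀ n, IsProbabilityMeasure (μ.map (U n)) := fun n =>
    Measure.isProbabilityMeasure_map (hUm n).aemeasurable
  have hprX : ∀ n, IsProbabilityMeasure (μ.map (X n)) := fun n =>
    Measure.isProbabilityMeasure_map (hXm n).aemeasurable
  have hUeq : ∀ n, μ.map (U n) = μ.map (U 0) := fun n => (hU n).trans (hU 0).symm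
  have hXeq : ∀ n, μ.map (X n) = μ.map (X 0) := fun n =>
    measure_bool_ext ((hXt n).trans (hXt 0).symm)
  have hUmeas : Measurable fun ω n => U n ω := measurable_pi_lambda _ hUm
  have hXmeas : Measurable fun ω n => X n ω := measurable_pi_lambda _ hXm
  have hlaw : μ.map (fun ω => ((fun n => U n ω), fun n => X n ω))
      = seedLaw (μ.map (U 0)) (μ.map (X 0)) := by
    rw [hUX.map_prod_eq_prod_map_map hUmeas.aemeasurable hXmeas.aemeasurable,
      hUi.map_fun_eq_infinitePi_map hUm, hXi.map_fun_eq_infinitePi_map hXm]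
    simp_rw [hUeq, hXeq]
    rfl
  have hmean : ∀ n, ∫⁻ ω, ((bfRun C 1 ε (fun n => U n ω) (fun n => X n ω) n).flips : ℝ≥0∞) ∂μ
      = bfMean (μ.map (U 0)) (μ.map (X 0)) n (.bf2 C 1 ε) := by
    intro n
    rw [bfMean, ← hlaw, lintegral_map (measurable_coe_bfCount n _) (hUmeas.prodMk hXmeas)]
    simp_rw [bfRun_flips]
  have hmeas : ∀ n, Measurable fun ω =>
      ((bfRun C 1 ε (fun n => U n ω) (fun n => X n ω) n).flips : ℝ≥0∞) := by
    intro n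
    simp_rw [bfRun_flips]
    exact (measurable_coe_bfCount n _).comp (hUmeas.prodMk hXmeas)
  have hmono : Monotone fun n ω =>
      ((bfRun C 1 ε (fun n => U n ω) (fun n => X n ω) n).flips : ℝ≥0∞) := fun m n hmn ω => by
    exact Nat.cast_le.2 (bfRun_flips_mono C 1 ε (fun n => U n ω) (fun n => X n ω) hmn)
  unfold bfDraws
  -- Monotone convergence needs no proof of termination.
  rw [lintegral_iSup hmeas hmono]
  refine iSup_le fun n => ?_
  rw [hmean]
  have h1 : ((1 : ℕ) : ℝ) ≤ 3.55 / ε + 1 := by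
    have : 0 < 3.55 / ε := by positivity
    push_cast
    linarith
  refine ((bfMean_le (μ.map (U 0)) (μ.map (X 0)) hp0 hp1 (fun t _ h1 =>
    uniform_measure_lt (hU 0) h1) (hXt 0) n C ε 1 hC0 hε0 hε1 hCp).1 h1).trans ?_
  rw [bfPotential_one hε0 hCp]
  refine ENNReal.ofReal_le_ofReal ?_
  nlinarith
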